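/- There is an absolute constant $C$ such that the following holds for every integer $k \ge 1$ and every finite undirected graph $G=(V,E)$, possibly with parallel edges. Call $G$ $m$-edge-connected if for every non-empty $S \subsetneq V$ at least $m$ edges have one endpoint in $S$ and the other in $V \setminus S$. An orientation of $G$ chooses one of the two directions for each edge; it is $k$-edge-connected if for every non-empty $S \subsetneq V$ at least $k$ directed edges leave $S$ and at least $k$ directed edges enter $S$. The edge-flip graph $\mathcal{G}_k(G)$ has the $k$-edge-connected orientations of $G$ as its vertices, and two of them are adjacent if and only if one is obtained from the other by reversing the direction of a single edge. If $G$ is $(2k+2)$-edge-connected, then $\mathcal{G}_k(G)$ is connected (in particular, non-empty), and its diameter is at most $C\,(k|V|^3+|E|^2)$. -/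

import Mathlib

open scoped Graph

namespace Graph

/-- The edges of the multigraph `G` with one endpoint in `S` and the other one outside `S`. -/
def edgeCut {V E : Type*} (G : Graph V E) (S : Set V) : Set E :=
  {e | ∃ x y, G.IsLink e x y ∧ x ∈ S ∧ y ∉ S}

/-- `G` is `k`-edge-connected: every nonempty proper vertex subset is separated from its
complement by at least `k` edges. -/
def IsEdgeConnected {V E : Type*} (G : Graph V E) (k : ℕ) : Prop :=
  ∀ S : Set V, S.Nonempty → S ⊂ V(G) → (k : ℕ∞) ≤ (G.edgeCut S).encard

/-- An orientation of the multigraph `G`: each edge gets one of its endpoints as tail and the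
other one as head. -/
@[ext]
structure Orientation {V E : Type*} (G : Graph V E) where
  /-- the tail of each edge -/
  tail : E(G) → V
  /-- the head of each edge -/
  head : E(G) → V
  /-- tail and head are the two endpoints of the edge -/
  isLink : ∀ e : E(G), G.IsLink e (tail e) (head e)

namespace Orientation

/-- The directed edges that leave `S`. -/
def outCut {V E : Type*} {G : Graph V E} (D : G.Orientation) (S : Set V) : Set E(G) :=
  {e | D.tail e ∈ S ∧ D.head e ∉ S}

/-- The directed edges that enter `S`. -/
def inCut {V E : Type*} {G : Graph V E} (D : G.Orientation) (S : Set V) : Set E(G) :=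
  {e | D.tail e ∉ S ∧ D.head e ∈ S}

/-- The directed graph `D` is `k`-edge-connected: every nonempty proper vertex subset is left by
at least `k` edges and entered by at least `k` edges. -/
def IsEdgeConnected {V E : Type*} {G : Graph V E} (D : G.Orientation) (k : ℕ) : Prop :=
  ∀ S : Set V, S.Nonempty → S ⊂ V(G) →
    (k : ℕ∞) ≤ (D.outCut S).encard ∧ (k : ℕ∞) ≤ (D.inCut S).encard

/-- `D'` is obtained from `D` by a single edge flip, that is, by reversing the direction of
exactly one edge. -/
def IsFlip {V E : Type*} {G : Graph V E} (D D' : G.Orientation) : Prop :=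
  ∃ e : E(G), D'.tail e = D.head e ∧ D'.head e = D.tail e ∧
    ∀ f : E(G), f ≠ e → D'.tail f = D.tail f ∧ D'.head f = D.head f

end Orientation

/-- The edge-flip graph: its vertices are the `k`-edge-connected orientations of `G`, and two
distinct ones are adjacent if one is obtained from the other by a single edge flip. -/
def edgeFlipGraph {V E : Type*} (G : Graph V E) (k : ℕ) :
    SimpleGraph {D : G.Orientation // D.IsEdgeConnected k} :=
  SimpleGraph.fromRel fun D D' => D.1.IsFlip D'.1

end Graph

namespace EdgeFlip

open Finset

/-! ### Cut values, tight sets and the symmetry under reversal -/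

section

variable {V E : Type*} [Fintype V] [DecidableEq V] [Fintype E]

/-! Any two `k`-edge-connected orientations are joined in three stretches: raise each of them to a
`(k + 1)`-edge-connected orientation (`exists_flips_isConn_succ`), then connect the two raised ones
(`flips_of_isConn`). Both tasks reverse directed paths arc by arc. Reversing a path from `s` to `v`
lowers by one exactly the out-degrees of sets containing `s` but not `v`, so every prefix of the
path can be checked through its ends alone.

Raising. The obstacles are the tight sets. As every cut has at least `2k + 2` edges, a tight set has
in- and out-degree differing by at least 2; counting these excesses yields good end vertices `t` in
a minimal out-tight set and `s` in a minimal in-tight set `S` (`exists_good_vertex`). Inside a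
minimal set mixing both kinds of tightness, or in the whole graph if there is none, some path from
`s` to `t` has no prefix leaving an out-tight set (`Region.exists_source`,
`Region.mem_of_outTight`). After its reversal every tight set contains an old one, and `S` is no
longer tight (`Region.exists_flips`). Minimal tight sets are pairwise disjoint, so a potential of at
most `|V|^2` drops in each round of at most `|V|` flips.

Connecting. With connectivity `k + 1`, each cut has one unit to spare. Path reversals first equalise
the out-degrees (`exists_exchange`); the remaining difference is then flipped along trails
(`flips_of_outDeg_eq`). -/

/-- The number of arcs of `D` that leave `Q`. -/
def outDeg (D : E → V × V) (Q : Finset V) : ℕ := #{e | (D e).1 ∈ Q ∧ (D e).2 ∉ Q}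

/-- Every nonempty proper vertex subset is left (hence also entered) by at least `k` arcs. -/
def IsConn (k : ℕ) (D : E → V × V) : Prop :=
  ∀ Q : Finset V, Q.Nonempty → Q ≠ univ → k ≤ outDeg D Q

/-- The underlying undirected graph of `D` is `m`-edge-connected. -/
def IsUConn (m : ℕ) (D : E → V × V) : Prop :=
  ∀ Q : Finset V, Q.Nonempty → Q ≠ univ → m ≤ outDeg D Q + outDeg D Qᶜ

/-- `D` with all arcs reversed. -/
def rev (D : E → V × V) : E → V × V := fun e => (D e).swap

/-- `D` with the arc `e` reversed. -/
def flip [DecidableEq E] (D : E → V × V) (e : E) : E → V × V := Function.update D e (D e).swap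

/-- A nonempty proper vertex subset left by exactly `k` arcs. -/
def OutTight (k : ℕ) (D : E → V × V) (Q : Finset V) : Prop :=
  Q.Nonempty ∧ Q ≠ univ ∧ outDeg D Q = k

/-- A nonempty proper vertex subset entered by exactly `k` arcs. -/
def InTight (k : ℕ) (D : E → V × V) (Q : Finset V) : Prop :=
  Q.Nonempty ∧ Q ≠ univ ∧ outDeg D Qᶜ = k

/-- A set that is tight in one of the two directions. -/
def Tight (k : ℕ) (D : E → V × V) (Q : Finset V) : Prop := OutTight k D Q ∨ InTight k D Q

variable {k : ℕ} {D : E → V × V}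

omit [Fintype V] in
lemma outDeg_inter_add_union_le (D : E → V × V) (A B : Finset V) :
    outDeg D (A ∩ B) + outDeg D (A ∪ B) ≤ outDeg D A + outDeg D B := by
  simp only [outDeg, card_filter, ← sum_add_distrib]
  refine sum_le_sum fun e _ => ?_
  simp only [mem_inter, mem_union]
  by_cases h1 : (D e).1 ∈ A <;> by_cases h2 : (D e).1 ∈ B <;> by_cases h3 : (D e).2 ∈ A <;>
    by_cases h4 : (D e).2 ∈ B <;> simp [h1, h2, h3, h4]

lemma outDeg_compl_inter_add_union_le (D : E → V × V) (A B : Finset V) :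
    outDeg D (A ∩ B)ᶜ + outDeg D (A ∪ B)ᶜ ≤ outDeg D Aᶜ + outDeg D Bᶜ := by
  have := outDeg_inter_add_union_le D Aᶜ Bᶜ
  rw [← compl_union, ← compl_inter] at this
  omega

lemma outDeg_sdiff_add_le (D : E → V × V) (A B : Finset V) :
    outDeg D (A \ B) + outDeg D (B \ A)ᶜ ≤ outDeg D A + outDeg D Bᶜ := by
  have := outDeg_inter_add_union_le D A Bᶜ
  have h1 : A ∩ Bᶜ = A \ B := by ext; simp
  have h2 : A ∪ Bᶜ = (B \ A)ᶜ := by ext; simp; tauto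
  rwa [h1, h2] at this

lemma outDeg_rev (D : E → V × V) (Q : Finset V) : outDeg (rev D) Q = outDeg D Qᶜ := by
  simp only [outDeg, rev, Prod.fst_swap, Prod.snd_swap, mem_compl, not_not]
  congr 1; ext; simp [and_comm]

lemma outTight_rev {Q : Finset V} : OutTight k (rev D) Q ↔ InTight k D Q := by
  simp [OutTight, InTight, outDeg_rev]

lemma inTight_rev {Q : Finset V} : InTight k (rev D) Q ↔ OutTight k D Q := by
  simp [OutTight, InTight, outDeg_rev]

lemma tight_rev {Q : Finset V} : Tight k (rev D) Q ↔ Tight k D Q := by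
  simp [Tight, outTight_rev, inTight_rev, or_comm]

lemma inTight_compl {Q : Finset V} : InTight k D Qᶜ ↔ OutTight k D Q := by
  simp only [InTight, OutTight, compl_compl, nonempty_iff_ne_empty, ne_eq, compl_eq_empty_iff,
    compl_eq_univ_iff]
  tauto

lemma outTight_compl {Q : Finset V} : OutTight k D Qᶜ ↔ InTight k D Q := by
  rw [← inTight_compl, compl_compl]

omit [Fintype E] [Fintype V] [DecidableEq V] in
lemma rev_rev (D : E → V × V) : rev (rev D) = D := by
  funext e; simp [rev]

lemma IsConn.compl_le (h : IsConn k D) {Q : Finset V} (h1 : Q.Nonempty) (h2 : Q ≠ univ) :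
    k ≤ outDeg D Qᶜ := by
  refine h _ ?_ ?_
  · rwa [nonempty_iff_ne_empty, ne_eq, compl_eq_empty_iff]
  · rwa [ne_eq, compl_eq_univ_iff, ← ne_eq, ← nonempty_iff_ne_empty]

lemma IsConn.rev (h : IsConn k D) : IsConn k (rev D) := fun Q h1 h2 => by
  rw [outDeg_rev]; exact h.compl_le h1 h2

lemma IsUConn.rev {m : ℕ} (h : IsUConn m D) : IsUConn m (rev D) := fun Q h1 h2 => by
  rw [outDeg_rev, outDeg_rev, compl_compl, add_comm]; exact h Q h1 h2

omit [DecidableEq V] in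
lemma ne_univ_of_subset {A B : Finset V} (h : A ⊆ B) (hB : B ≠ univ) : A ≠ univ := by
  rintro rfl; exact hB (univ_subset_iff.1 h)

/-! ### Uncrossing tight sets -/

section Uncross
variable {A B : Finset V}

lemma IsConn.outTight_inter (h : IsConn k D) (hA : OutTight k D A) (hB : OutTight k D B)
    (hi : (A ∩ B).Nonempty) (hu : A ∪ B ≠ univ) : OutTight k D (A ∩ B) := by
  have h0 : A ∩ B ≠ univ := ne_univ_of_subset inter_subset_left hA.2.1
  have h1 := outDeg_inter_add_union_le D A B
  have h2 := h _ hi h0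
  have h3 := h _ (hA.1.mono subset_union_left) hu
  have := hA.2.2
  have := hB.2.2
  exact ⟨hi, h0, by omega⟩

lemma IsConn.outTight_union (h : IsConn k D) (hA : OutTight k D A) (hB : OutTight k D B)
    (hi : (A ∩ B).Nonempty) (hu : A ∪ B ≠ univ) : OutTight k D (A ∪ B) := by
  have h0 : A ∩ B ≠ univ := ne_univ_of_subset inter_subset_left hA.2.1
  have h1 := outDeg_inter_add_union_le D A B
  have h2 := h _ hi h0
  have h3 := h _ (hA.1.mono subset_union_left) hu
  have := hA.2.2
  have := hB.2.2
  exact ⟨hA.1.mono subset_union_left, hu, by omega⟩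

lemma IsConn.inTight_inter (h : IsConn k D) (hA : InTight k D A) (hB : InTight k D B)
    (hi : (A ∩ B).Nonempty) (hu : A ∪ B ≠ univ) : InTight k D (A ∩ B) :=
  outTight_rev.1 (h.rev.outTight_inter (outTight_rev.2 hA) (outTight_rev.2 hB) hi hu)

lemma IsConn.inTight_union (h : IsConn k D) (hA : InTight k D A) (hB : InTight k D B)
    (hi : (A ∩ B).Nonempty) (hu : A ∪ B ≠ univ) : InTight k D (A ∪ B) :=
  outTight_rev.1 (h.rev.outTight_union (outTight_rev.2 hA) (outTight_rev.2 hB) hi hu)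

/-- This is uncrossing of `A` with the out-tight set `Bᶜ`. Unlike for two sets of the same kind, it
works even if `A` and `B` cover everything. -/
lemma IsConn.tight_sdiff (h : IsConn k D) (hA : OutTight k D A) (hB : InTight k D B)
    (h1 : ¬ A ⊆ B) (h2 : ¬ B ⊆ A) : OutTight k D (A \ B) ∧ InTight k D (B \ A) := by
  rw [← sdiff_nonempty] at h1 h2
  have h3 : A \ B ≠ univ := ne_univ_of_subset sdiff_subset hA.2.1
  have h4 : B \ A ≠ univ := ne_univ_of_subset sdiff_subset hB.2.1
  have h5 := outDeg_sdiff_add_le D A B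
  have h6 := h _ h1 h3
  have h7 := h.compl_le h2 h4
  have := hA.2.2
  have := hB.2.2
  exact ⟨⟨h1, h3, by omega⟩, ⟨h2, h4, by omega⟩⟩

lemma IsUConn.not_inTight_of_outTight (hG : IsUConn (2 * k + 2) D) (hA : OutTight k D A) :
    ¬ InTight k D A := by
  intro hB
  have := hG A hA.1 hA.2.1
  have := hA.2.2
  have := hB.2.2
  omega

lemma minimal_tight_disjoint (h : IsConn k D) (hG : IsUConn (2 * k + 2) D)
    (hA : Minimal (Tight k D) A) (hB : Minimal (Tight k D) B) (hne : A ≠ B) : Disjoint A B := by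
  have key : ∀ {D : E → V × V} {A B : Finset V}, IsConn k D → IsUConn (2 * k + 2) D →
      Minimal (Tight k D) A → Minimal (Tight k D) B → A ≠ B → OutTight k D A →
      Disjoint A B := by
    clear hA hB hne hG h
    intro D A B h hG hA hB hne hA'
    by_contra hd
    rw [not_disjoint_iff_nonempty_inter] at hd
    have hAB : ¬ A ⊆ B := fun hs => hne (hB.eq_of_le hA.prop hs)
    have hBA : ¬ B ⊆ A := fun hs => hne (hA.eq_of_le hB.prop hs).symm
    obtain ⟨x, hx⟩ := hd
    rw [mem_inter] at hx
    rcases hB.prop with hB' | hB'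
    -- If the two sets cover everything, the complement of one is a tight set inside the other; this
    -- is why minimality has to be among both kinds.
    · by_cases hu : A ∪ B = univ
      · have h1 : Bᶜ ⊆ A := by
          intro y hy
          have : y ∈ A ∪ B := hu ▸ mem_univ y
          exact (mem_union.1 this).resolve_right (mem_compl.1 hy)
        have := hA.eq_of_le (Or.inr (inTight_compl.2 hB')) h1
        rw [← this] at hx
        exact mem_compl.1 hx.1 hx.2
      · have h1 := h.outTight_inter hA' hB' ⟨x, mem_inter.2 hx⟩ hu
        have := hA.eq_of_le (Or.inl h1) inter_subset_left
        exact hAB (inter_eq_left.1 this)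
    · have h1 := (h.tight_sdiff hA' hB' hAB hBA).1
      have := hA.eq_of_le (Or.inl h1) sdiff_subset
      rw [← this] at hx
      exact (mem_sdiff.1 hx.1).2 hx.2
  rcases hA.prop with hA' | hA'
  · exact key h hG hA hB hne hA'
  · have ht : Tight k (rev D) = Tight k D := by funext Q; exact propext tight_rev
    exact key h.rev hG.rev (ht ▸ hA) (ht ▸ hB) hne (outTight_rev.2 hA')

end Uncross

/-! ### Excess -/

/-- Out-degree minus in-degree of a vertex. -/
def excess (D : E → V × V) (v : V) : ℤ := (#{e | (D e).1 = v} : ℤ) - #{e | (D e).2 = v}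

lemma sum_excess (D : E → V × V) (Q : Finset V) :
    ∑ v ∈ Q, excess D v = (outDeg D Q : ℤ) - outDeg D Qᶜ := by
  simp only [excess, outDeg, card_filter, sum_sub_distrib]
  push_cast
  rw [sum_comm, sum_comm (s := Q), ← sum_sub_distrib, ← sum_sub_distrib]
  refine sum_congr rfl fun e _ => ?_
  simp only [sum_ite_eq, mem_compl, not_not]
  by_cases h1 : (D e).1 ∈ Q <;> by_cases h2 : (D e).2 ∈ Q <;> simp [h1, h2]

omit [Fintype V] in
/-- If a family of sets is closed under unions of intersecting members and all members have
nonnegative weight, then so has the union of the family. -/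
lemma sum_sup_nonneg (𝓕 : Finset (Finset V)) (g : V → ℤ)
    (hun : ∀ A ∈ 𝓕, ∀ B ∈ 𝓕, (A ∩ B).Nonempty → A ∪ B ∈ 𝓕)
    (hg : ∀ A ∈ 𝓕, 0 ≤ ∑ v ∈ A, g v) : 0 ≤ ∑ v ∈ 𝓕.sup id, g v := by
  classical
  -- The maximal members are pairwise disjoint and have the same union, so the sum splits over them.
  set 𝓜 : Finset (Finset V) := {A ∈ 𝓕 | Maximal (· ∈ 𝓕) A} with h𝓜
  have hsup : 𝓕.sup id = 𝓜.biUnion id := by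
    ext v
    simp only [mem_sup, mem_biUnion, id]
    constructor
    · rintro ⟨A, hA, hv⟩
      obtain ⟨B, hAB, hB⟩ := exists_le_maximal (s := 𝓕) hA
      exact ⟨B, by simp [h𝓜, hB, hB.prop], hAB hv⟩
    · rintro ⟨A, hA, hv⟩
      exact ⟨A, (mem_filter.1 hA).1, hv⟩
  rw [hsup, sum_biUnion]
  · exact sum_nonneg fun A hA => hg A (mem_filter.1 hA).1
  · intro A hA B hB hne
    simp only [h𝓜, coe_filter, Set.mem_ofPred_eq] at hA hB
    by_contra hd
    simp only [Function.onFun, id, not_disjoint_iff_nonempty_inter] at hd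
    have hU := hun A hA.1 B hB.1 hd
    exact hne ((hA.2.eq_of_le hU subset_union_left).trans
      (hB.2.eq_of_le hU subset_union_right).symm)

/-- A minimal out-tight set has a vertex at which the in-degrees of all its subsets can be
decreased without creating an in-tight set that contains no former one. -/
lemma exists_good_vertex (h : IsConn k D) (hG : IsUConn (2 * k + 2) D) {T : Finset V}
    (hT : Minimal (OutTight k D) T) :
    ∃ t ∈ T, (∀ Z ⊆ T, InTight k D Z → t ∉ Z) ∧
      ∀ Y ⊆ T, t ∈ Y → outDeg D Yᶜ ≤ k + 1 → ∃ Z ⊆ Y, InTight k D Z := by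
  classical
  have hTu := hT.prop.2.1
  -- The sets that `t` has to avoid. In-degree at most `k + 1` forces out-degree at least `k + 1`,
  -- so each has nonnegative excess.
  set 𝓕 : Finset (Finset V) := {Y | Y ⊆ T ∧ Y.Nonempty ∧ (InTight k D Y ∨
    (outDeg D Yᶜ = k + 1 ∧ ∀ Z ⊆ T, InTight k D Z → Disjoint Y Z))} with h𝓕
  have hun : ∀ A ∈ 𝓕, ∀ B ∈ 𝓕, (A ∩ B).Nonempty → A ∪ B ∈ 𝓕 := by
    intro A hA B hB hAB
    simp only [h𝓕, mem_filter, mem_univ, true_and] at hA hB ⊢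
    obtain ⟨hAT, hAn, hA⟩ := hA
    obtain ⟨hBT, hBn, hB⟩ := hB
    have hABT := union_subset hAT hBT
    have hABu := ne_univ_of_subset hABT hTu
    have hABn := hAn.mono (subset_union_left (s₂ := B))
    refine ⟨hABT, hABn, ?_⟩
    rcases hA with hA | hA <;> rcases hB with hB | hB
    · exact Or.inl (h.inTight_union hA hB hAB hABu)
    · exact absurd (hB.2 A hAT hA).symm (not_disjoint_iff_nonempty_inter.2 hAB)
    · exact absurd (hA.2 B hBT hB) (not_disjoint_iff_nonempty_inter.2 hAB)
    · right
      have hd : ∀ Z ⊆ T, InTight k D Z → Disjoint (A ∪ B) Z := fun Z hZ hZ' =>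
        disjoint_union_left.2 ⟨hA.2 Z hZ hZ', hB.2 Z hZ hZ'⟩
      refine ⟨?_, hd⟩
      have h1 := outDeg_compl_inter_add_union_le D A B
      have hIu : A ∩ B ≠ univ := ne_univ_of_subset inter_subset_union hABu
      have h2 := h.compl_le hAB hIu
      have h3 := h.compl_le hABn hABu
      have h4 : outDeg D (A ∩ B)ᶜ ≠ k := fun h4 => by
        have := hA.2 _ (inter_subset_left.trans hAT) ⟨hAB, hIu, h4⟩
        exact hAB.ne_empty (disjoint_self.1 (this.mono_left inter_subset_left))
      have h5 : outDeg D (A ∪ B)ᶜ ≠ k := fun h5 =>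
        hABn.ne_empty (disjoint_self.1 (hd _ hABT ⟨hABn, hABu, h5⟩))
      omega
  have hg : ∀ A ∈ 𝓕, 0 ≤ ∑ v ∈ A, excess D v := by
    intro A hA
    simp only [h𝓕, mem_filter, mem_univ, true_and] at hA
    obtain ⟨hAT, hAn, hA⟩ := hA
    have h1 := hG A hAn (ne_univ_of_subset hAT hTu)
    rw [sum_excess]
    rcases hA with hA | hA
    · have := hA.2.2
      omega
    · omega
  have hsum := sum_sup_nonneg 𝓕 _ hun hg
  -- `T` itself has out-degree `k` and in-degree at least `k + 2`, hence negative excess.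
  have hne : 𝓕.sup id ≠ T := by
    intro he
    rw [he, sum_excess] at hsum
    have := hG T hT.prop.1 hTu
    have := hT.prop.2.2
    omega
  have hsub : 𝓕.sup id ⊆ T := by
    intro v hv
    simp only [mem_sup, id, h𝓕, mem_filter, mem_univ, true_and] at hv
    obtain ⟨A, hA, hv⟩ := hv
    exact hA.1 hv
  obtain ⟨t, htT, ht⟩ := exists_of_ssubset (hsub.ssubset_of_ne hne)
  simp only [mem_sup, id, h𝓕, mem_filter, mem_univ, true_and, not_exists, not_and] at ht
  have ht1 : ∀ Z ⊆ T, InTight k D Z → t ∉ Z := fun Z hZ hZ' => ht Z ⟨hZ, hZ'.1, Or.inl hZ'⟩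
  refine ⟨t, htT, ht1, fun Y hY htY hYk => ?_⟩
  have hYu := ne_univ_of_subset hY hTu
  have hYn : Y.Nonempty := ⟨t, htY⟩
  have h1 := h.compl_le hYn hYu
  by_cases hYt : outDeg D Yᶜ = k
  · exact ⟨Y, Subset.rfl, hYn, hYu, hYt⟩
  -- Now `Y` has in-degree `k + 1` and contains `t`, so it is not in the family and meets an
  -- in-tight `Z`. The union contains `t` and is not in-tight, which leaves in-degree `k` for the
  -- intersection.
  have h2 : ∃ Z ⊆ T, InTight k D Z ∧ ¬ Disjoint Y Z := by
    by_contra! hcon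
    exact ht Y ⟨hY, hYn, Or.inr ⟨by omega, hcon⟩⟩ htY
  obtain ⟨Z, hZT, hZ, hYZ⟩ := h2
  rw [not_disjoint_iff_nonempty_inter] at hYZ
  have hUT := union_subset hY hZT
  have hUu := ne_univ_of_subset hUT hTu
  have hIu : Y ∩ Z ≠ univ := ne_univ_of_subset inter_subset_union hUu
  have hUn := hYn.mono (subset_union_left (s₂ := Z))
  have h3 := outDeg_compl_inter_add_union_le D Y Z
  have h4 := h.compl_le hYZ hIu
  have h5 := h.compl_le hUn hUu
  have h6 : outDeg D (Y ∪ Z)ᶜ ≠ k := fun h6 => ht1 _ hUT ⟨hUn, hUu, h6⟩ (mem_union_left _ htY)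
  have := hZ.2.2
  exact ⟨Y ∩ Z, inter_subset_left, hYZ, hIu, by omega⟩

end

/-! ### Reorientations, degrees and sequences of flips -/

section

variable {V E : Type*} [Fintype V] [DecidableEq V] [Fintype E]
variable {k : ℕ} {D : E → V × V}

/-- The indicator function of `Q`. -/
def ind (Q : Finset V) (v : V) : ℤ := if v ∈ Q then 1 else 0

omit [Fintype V] in
lemma ind_nonneg (Q : Finset V) (v : V) : 0 ≤ ind Q v := by unfold ind; split_ifs <;> simp

omit [Fintype V] in
lemma ind_le_one (Q : Finset V) (v : V) : ind Q v ≤ 1 := by unfold ind; split_ifs <;> simp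

/-- `D` and `D'` orient the same undirected graph. -/
def Same (D D' : E → V × V) : Prop := ∀ e, D' e = D e ∨ D' e = (D e).swap

omit [Fintype V] [DecidableEq V] [Fintype E] in
lemma Same.refl (D : E → V × V) : Same D D := fun _ => Or.inl rfl

omit [Fintype V] [DecidableEq V] [Fintype E] in
lemma Same.trans {D D' D'' : E → V × V} (h : Same D D') (h' : Same D' D'') : Same D D'' := by
  intro e
  rcases h e with h | h <;> rcases h' e with h' | h' <;> simp [h, h']

omit [Fintype V] [DecidableEq V] [Fintype E] in
lemma Same.symm {D D' : E → V × V} (h : Same D D') : Same D' D := by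
  intro e
  rcases h e with h | h <;> simp [h]

omit [Fintype V] [DecidableEq V] [Fintype E] in
lemma same_flip [DecidableEq E] (D : E → V × V) (e : E) : Same D (flip D e) := by
  intro f
  by_cases h : f = e
  · subst h; simp [flip]
  · simp [flip, h]

lemma Same.outDeg_add {D D' : E → V × V} (h : Same D D') (Q : Finset V) :
    outDeg D' Q + outDeg D' Qᶜ = outDeg D Q + outDeg D Qᶜ := by
  simp only [outDeg, card_filter, ← sum_add_distrib]
  refine sum_congr rfl fun e _ => ?_
  rcases h e with h | h <;> rw [h]
  simp only [Prod.fst_swap, Prod.snd_swap, mem_compl, not_not]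
  rw [add_comm]
  simp only [and_comm]

lemma Same.isUConn {D D' : E → V × V} {m : ℕ} (h : Same D D') (hD : IsUConn m D) :
    IsUConn m D' := fun Q h1 h2 => by rw [h.outDeg_add]; exact hD Q h1 h2

/-- The out-degree of a vertex, loops included. -/
def deg (D : E → V × V) (v : V) : ℕ := #{e | (D e).1 = v}

/-- The number of arcs inside `Q`. -/
def inside (D : E → V × V) (Q : Finset V) : ℕ := #{e | (D e).1 ∈ Q ∧ (D e).2 ∈ Q}

omit [Fintype V] in
lemma Same.inside_eq {D D' : E → V × V} (h : Same D D') (Q : Finset V) :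
    inside D' Q = inside D Q := by
  unfold inside
  congr 1
  ext e
  rcases h e with h | h <;> simp [h, and_comm]

omit [Fintype V] in
-- As `inside` is the same for all orientations of a graph, the out-degrees of the vertices
-- determine all cut values.
lemma sum_deg (D : E → V × V) (Q : Finset V) :
    ∑ v ∈ Q, deg D v = outDeg D Q + inside D Q := by
  simp only [deg, outDeg, inside, card_filter, ← sum_add_distrib]
  rw [sum_comm]
  refine sum_congr rfl fun e _ => ?_
  by_cases h1 : (D e).1 ∈ Q <;> by_cases h2 : (D e).2 ∈ Q <;> simp [h1, h2]

omit [Fintype V] in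
lemma deg_eq (D : E → V × V) (v : V) : deg D v = outDeg D {v} + inside D {v} := by
  rw [← sum_deg]; simp

lemma sum_deg_univ (D : E → V × V) : ∑ v, deg D v = Fintype.card E := by
  rw [sum_deg]; simp [outDeg, inside]

section Flips
variable [DecidableEq E]

omit [Fintype V] in
-- In this form, valid for every position of `e` relative to `Q`, the changes along a path telescope
-- to its two ends.
lemma outDeg_flip (D : E → V × V) (e : E) (Q : Finset V) :
    (outDeg (flip D e) Q : ℤ) = outDeg D Q - ind Q (D e).1 + ind Q (D e).2 := by
  simp only [outDeg, card_filter]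
  push_cast
  rw [← add_sum_erase _ _ (mem_univ e), ← add_sum_erase univ _ (mem_univ e)]
  have : ∑ f ∈ univ.erase e,
      (if (flip D e f).1 ∈ Q ∧ (flip D e f).2 ∉ Q then (1 : ℤ) else 0) =
      ∑ f ∈ univ.erase e, (if (D f).1 ∈ Q ∧ (D f).2 ∉ Q then (1 : ℤ) else 0) := by
    refine sum_congr rfl fun f hf => ?_
    simp [flip, (mem_erase.1 hf).1]
  rw [this]
  simp only [flip, Function.update_self, ind, Prod.fst_swap, Prod.snd_swap]
  by_cases h1 : (D e).1 ∈ Q <;> by_cases h2 : (D e).2 ∈ Q <;> simp [h1, h2]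
  ring

/-- `D'` arises from `D` by at most `n` flips of single arcs, each of which results in a
`k`-edge-connected digraph. -/
inductive Flips (k : ℕ) : ℕ → (E → V × V) → (E → V × V) → Prop
  | refl (n : ℕ) (D : E → V × V) : Flips k n D D
  | tail {n : ℕ} {D D' : E → V × V} (e : E) (h : Flips k n D D')
      (h' : IsConn k (flip D' e)) : Flips k (n + 1) D (flip D' e)

lemma Flips.mono {m n : ℕ} {D D' : E → V × V} (h : Flips k m D D') (hmn : m ≤ n) :
    Flips k n D D' := by
  induction h generalizing n with
  | refl => exact .refl _ _
  | tail e h h' ih =>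
    obtain ⟨n, rfl⟩ : ∃ l, n = l + 1 := ⟨n - 1, by omega⟩
    exact .tail e (ih (by omega)) h'

lemma Flips.trans {m n : ℕ} {D D' D'' : E → V × V} (h : Flips k m D D') (h' : Flips k n D' D'') :
    Flips k (m + n) D D'' := by
  induction h' with
  | refl => exact h.mono (by omega)
  | tail e _ h' ih => exact .tail e (ih h) h'

lemma Flips.head {n : ℕ} {D D' : E → V × V} (e : E) (hc : IsConn k (flip D e))
    (h : Flips k n (flip D e) D') : Flips k (n + 1) D D' := by
  rw [add_comm]
  exact Flips.trans (.tail e (.refl 0 D) hc) h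

lemma Flips.same {n : ℕ} {D D' : E → V × V} (h : Flips k n D D') : Same D D' := by
  induction h with
  | refl => exact .refl _
  | tail e _ _ ih => exact ih.trans (same_flip _ _)

lemma Flips.isConn {n : ℕ} {D D' : E → V × V} (h : Flips k n D D') (hD : IsConn k D) :
    IsConn k D' := by
  cases h with
  | refl => exact hD
  | tail _ _ h' => exact h'

omit [Fintype V] [DecidableEq V] [Fintype E] in
lemma flip_rev (D : E → V × V) (e : E) : flip (rev D) e = rev (flip D e) := by
  funext f
  by_cases h : f = e
  · subst h; simp [flip, rev]
  · simp [flip, rev, h]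

lemma Flips.rev {n : ℕ} {D D' : E → V × V} (h : Flips k n D D') :
    Flips k n (rev D) (rev D') := by
  induction h with
  | refl => exact .refl _ _
  | tail e _ h' ih =>
    rw [← flip_rev]
    exact .tail e ih (by rw [flip_rev]; exact h'.rev)

omit [Fintype V] [DecidableEq V] in
/-- Reachability can be witnessed by a simple path. -/
lemma exists_nodup_chain {r : V → V → Prop} {s t : V} (h : Relation.ReflTransGen r s t) :
    ∃ l : List V, List.IsChain r (s :: l) ∧ (s :: l).Nodup ∧
      (s :: l).getLast (List.cons_ne_nil _ _) = t := by
  induction h using Relation.ReflTransGen.head_induction_on with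
  | refl => exact ⟨[], by simp⟩
  | head hab _ ih =>
    rename_i a b _
    obtain ⟨l, h1, h2, h3⟩ := ih
    -- If `a` is already on the path, the closed part before it is cut off.
    by_cases ha : a ∈ b :: l
    · obtain ⟨l1, l2, hl⟩ := List.append_of_mem ha
      refine ⟨l2, ?_, ?_, ?_⟩
      · rw [hl] at h1
        exact h1.right_of_append
      · rw [hl] at h2
        exact h2.of_append_right
      · rw [← h3]
        simp only [hl]
        rw [List.getLast_append_of_ne_nil]
    · exact ⟨b :: l, List.isChain_cons_cons.2 ⟨hab, h1⟩, List.nodup_cons.2 ⟨ha, h2⟩, by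
        rw [List.getLast_cons (List.cons_ne_nil _ _)]; exact h3⟩

/-- Induction along the path: `D` is the original digraph and `D'` the one with an initial part
reversed. The path is simple, so arcs of `D` with tail on the rest of it are still unflipped. The
last hypothesis covers the digraph after each further flip, described by its cut values only. -/
lemma Flips.of_chain {r : V → V → Prop} (hr : ∀ a b, r a b → ∃ e, D e = (a, b)) :
    ∀ (l : List V) (a : V), List.IsChain r (a :: l) → (a :: l).Nodup →
    ∀ D' : E → V × V, (∀ e, (D e).1 ∈ a :: l → D' e = D e) →
    (∀ v ∈ l, ∀ D'' : E → V × V,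
      (∀ Q, (outDeg D'' Q : ℤ) = outDeg D' Q - ind Q a + ind Q v) → IsConn k D'') →
    ∃ D'', Flips k l.length D' D'' ∧ ∀ Q, (outDeg D'' Q : ℤ) =
      outDeg D' Q - ind Q a + ind Q ((a :: l).getLast (List.cons_ne_nil _ _)) := by
  intro l
  induction l with
  | nil => intro a _ _ D' _ _; exact ⟨D', .refl _ _, by simp⟩
  | cons b l ih =>
    intro a hc hn D' hD' hk
    rw [List.isChain_cons_cons] at hc
    rw [List.nodup_cons] at hn
    obtain ⟨e, he⟩ := hr a b hc.1
    have he' : D' e = (a, b) := by rw [← he]; exact hD' e (by simp [he])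
    have hfl : ∀ Q, (outDeg (flip D' e) Q : ℤ) = outDeg D' Q - ind Q a + ind Q b := by
      intro Q; rw [outDeg_flip, he']
    obtain ⟨D'', h1, h2⟩ := ih b hc.2 hn.2 (flip D' e) (by
      intro f hf
      have hfe : f ≠ e := by
        rintro rfl
        rw [he] at hf
        exact hn.1 hf
      rw [flip, Function.update_of_ne hfe]
      exact hD' f (List.mem_cons_of_mem _ hf)) (by
      intro v hv D'' hD''
      refine hk v (List.mem_cons_of_mem _ hv) D'' fun Q => ?_
      rw [hD'', hfl]; ring)
    refine ⟨D'', .head e (hk b (by simp) _ hfl) h1, fun Q => ?_⟩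
    rw [h2, hfl, List.getLast_cons (List.cons_ne_nil _ _)]
    ring

/-- Reversing a directed path arc by arc, starting at its first vertex. -/
lemma Flips.of_reflTransGen {r : V → V → Prop} (hr : ∀ a b, r a b → ∃ e, D e = (a, b)) {s t : V}
    (h : Relation.ReflTransGen r s t)
    (hk : ∀ v, Relation.ReflTransGen r s v → ∀ D'' : E → V × V,
      (∀ Q, (outDeg D'' Q : ℤ) = outDeg D Q - ind Q s + ind Q v) → IsConn k D'') :
    ∃ D', Flips k (Fintype.card V) D D' ∧
      ∀ Q, (outDeg D' Q : ℤ) = outDeg D Q - ind Q s + ind Q t := by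
  obtain ⟨l, h1, h2, rfl⟩ := exists_nodup_chain h
  obtain ⟨D', h3, h4⟩ := Flips.of_chain (k := k) hr l s h1 h2 D (fun _ _ => rfl) (by
    intro v hv
    refine hk v ?_
    exact h1.cons_induction (Relation.ReflTransGen r s) _ (fun _ _ hxy hx => hx.tail hxy) .refl _ hv)
  have := h2.length_le_card
  rw [List.length_cons] at this
  exact ⟨D', h3.mono (by omega), h4⟩

end Flips

end

section

variable {V E : Type*} [Fintype V] [DecidableEq V] [Fintype E] [DecidableEq E]
variable {k : ℕ} {D : E → V × V}

/-! ### Moving between two `(k + 1)`-edge-connected orientations -/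

omit [DecidableEq E] in
/-- If a vertex has too small out-degree in `D` compared to `D'`, then there is a vertex with too
large out-degree from which a path to it can be reversed. -/
lemma exists_exchange {D D' : E → V × V} (hs : Same D D') (h : IsConn k D) (h' : IsConn k D')
    {t : V} (ht : deg D t < deg D' t) :
    ∃ s, deg D' s < deg D s ∧ ∀ Q, OutTight k D Q → s ∈ Q → t ∈ Q := by
  classical
  by_contra! hcon
  -- If no `s` works, these sets cover all vertices whose out-degree is too large. On each of them,
  -- and so on their union, `D'` has at least the out-degree sum of `D`; outside the union no vertex
  -- has too large an out-degree and `t` has too small a one. But the total sums agree.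
  set 𝓕 : Finset (Finset V) := {Q | OutTight k D Q ∧ t ∉ Q} with h𝓕
  have hmem : ∀ {Q}, Q ∈ 𝓕 ↔ OutTight k D Q ∧ t ∉ Q := by simp [h𝓕]
  have hsum := sum_sup_nonneg 𝓕 (fun v => (deg D' v : ℤ) - deg D v) (by
    intro A hA B hB hAB
    rw [hmem] at hA hB ⊢
    have ht : t ∉ A ∪ B := by simp [hA.2, hB.2]
    exact ⟨h.outTight_union hA.1 hB.1 hAB fun hu => ht (hu ▸ mem_univ t), ht⟩) (by
    intro A hA
    rw [hmem] at hA
    have h1 := h' A hA.1.1 hA.1.2.1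
    have h2 := hA.1.2.2
    have h3 := sum_deg D A
    have h4 := sum_deg D' A
    rw [hs.inside_eq] at h4
    rw [sum_sub_distrib]
    push_cast [← Nat.cast_sum]
    omega)
  have hout : ∀ v ∈ (𝓕.sup id)ᶜ, 0 ≤ (deg D' v : ℤ) - deg D v := by
    intro v hv
    by_contra! hlt
    obtain ⟨Q, hQ, hvQ, htQ⟩ := hcon v (by omega)
    refine mem_compl.1 hv ?_
    rw [mem_sup]
    exact ⟨Q, hmem.2 ⟨hQ, htQ⟩, hvQ⟩
  have htc : t ∈ (𝓕.sup id)ᶜ := by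
    rw [mem_compl, mem_sup]
    rintro ⟨Q, hQ, htQ⟩
    exact (hmem.1 hQ).2 htQ
  have h1 := single_le_sum (f := fun v => (deg D' v : ℤ) - deg D v) hout htc
  have h2 := sum_add_sum_compl (𝓕.sup id) (fun v => (deg D' v : ℤ) - deg D v)
  rw [sum_sub_distrib (s := univ), ← Nat.cast_sum, ← Nat.cast_sum, sum_deg_univ,
    sum_deg_univ, sub_self] at h2
  omega

omit [DecidableEq E] in
lemma IsConn.reachable (h : IsConn k D) (hk : 1 ≤ k) (s t : V) :
    Relation.ReflTransGen (fun a b => ∃ e, D e = (a, b)) s t := by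
  classical
  by_contra hcon
  set Q : Finset V := {v | Relation.ReflTransGen (fun a b => ∃ e, D e = (a, b)) s v} with hQ
  have h1 := h Q ⟨s, by simp [hQ, Relation.ReflTransGen.refl]⟩ (fun hu => by
    have := hu ▸ mem_univ t
    simp only [hQ, mem_filter, mem_univ, true_and] at this
    exact hcon this)
  have : 0 < outDeg D Q := by omega
  obtain ⟨e, he⟩ := card_pos.1 this
  simp only [hQ, mem_filter, mem_univ, true_and] at he
  exact he.2 (he.1.tail ⟨e, rfl⟩)

/-- Midway each cut loses at most one arc, leaving `k`. At the end only sets with `s` inside and `t`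
outside have lost one, and by the choice of `s` these had more than `k + 1`. The truncated
differences sum the out-degree deficits: the one at `t` shrinks, the one at `s` stays 0. -/
lemma exists_flips_exchange {D D' : E → V × V} (hs : Same D D') (h : IsConn (k + 1) D)
    (h' : IsConn (k + 1) D') {t : V} (ht : deg D t < deg D' t) :
    ∃ D'', Flips k (Fintype.card V) D D'' ∧ IsConn (k + 1) D'' ∧
      ∑ v, (deg D' v - deg D'' v) < ∑ v, (deg D' v - deg D v) := by
  obtain ⟨s, hsd, hst⟩ := exists_exchange hs h h' ht
  obtain ⟨D'', h1, h2⟩ := Flips.of_reflTransGen (k := k) (fun _ _ h => h)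
    (h.reachable (by omega) s t) (by
      intro v _ D'' hD'' Q hQ hQu
      have := hD'' Q
      have := h Q hQ hQu
      have := ind_nonneg Q v
      have := ind_le_one Q s
      omega)
  have hne : s ≠ t := by rintro rfl; omega
  refine ⟨D'', h1, ?_, ?_⟩
  · intro Q hQ hQu
    have h3 := h2 Q
    have h4 := h Q hQ hQu
    have h5 := hst Q
    unfold ind at h3
    by_cases hsQ : s ∈ Q
    · by_cases htQ : t ∈ Q
      · simp only [hsQ, htQ, if_true] at h3
        omega
      · have : outDeg D Q ≠ k + 1 := fun h6 => htQ (h5 ⟨hQ, hQu, h6⟩ hsQ)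
        simp only [hsQ, htQ, if_true, if_false] at h3
        omega
    · simp only [hsQ, if_false] at h3
      split_ifs at h3 <;> omega
  · have hd : ∀ v, (deg D'' v : ℤ) = deg D v - (if s = v then 1 else 0) +
        (if t = v then 1 else 0) := by
      intro v
      rw [deg_eq, deg_eq, h1.same.inside_eq]
      push_cast
      rw [h2]
      simp only [ind, mem_singleton]
      ring
    refine sum_lt_sum (fun v _ => ?_) ⟨t, mem_univ t, ?_⟩
    · have := hd v
      split_ifs at this with h3 h4 h4
      · omega
      · subst h3; omega
      · omega
      · omega
    · have := hd t
      rw [if_neg hne, if_pos rfl] at this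
      omega

/-- Two orientations with nearly the same degrees are connected by flipping the arcs in which
they differ, following a trail. -/
lemma flips_of_outDeg_eq {D' : E → V × V} (h' : IsConn (k + 1) D') :
    ∀ (m : ℕ) (D : E → V × V) (a b : V), Same D D' → #{e | D e ≠ D' e} = m →
      (∀ Q, (outDeg D Q : ℤ) = outDeg D' Q + ind Q a - ind Q b) → Flips k m D D' := by
  intro m
  induction m with
  | zero =>
    intro D a b _ h0 _
    have : D = D' := by
      funext e
      by_contra hne
      rw [card_eq_zero] at h0
      exact notMem_empty e (h0 ▸ mem_filter.2 ⟨mem_univ e, hne⟩)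
    subst this
    exact .refl _ _
  | succ m ih =>
    intro D a b hs hm hab
    have main : ∀ e b, D e ≠ D' e →
        (∀ Q, (outDeg D Q : ℤ) = outDeg D' Q + ind Q (D e).1 - ind Q b) →
        Flips k (m + 1) D D' := by
      intro e b he hQ
      have hfl : ∀ Q, (outDeg (flip D e) Q : ℤ) = outDeg D' Q + ind Q (D e).2 - ind Q b := by
        intro Q
        rw [outDeg_flip, hQ]
        ring
      -- The trail moves on to the head of `e`. All cut values stay within one of those of `D'`,
      -- hence at least `k`.
      refine .head e ?_ (ih (flip D e) (D e).2 b ((same_flip D e).symm.trans hs) ?_ hfl)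
      · intro Q h1 h2
        have := h' Q h1 h2
        have := hfl Q
        have := ind_nonneg Q (D e).2
        have := ind_le_one Q b
        omega
      · have : (univ.filter fun f => flip D e f ≠ D' f) =
            (univ.filter fun f => D f ≠ D' f).erase e := by
          ext f
          rw [mem_erase, mem_filter, mem_filter]
          by_cases hf : f = e
          · subst hf
            simp [flip, (hs f).resolve_left (Ne.symm he)]
          · simp [flip, hf]
        rw [this, card_erase_of_mem (by simpa using he), hm]
        rfl
    -- A closed trail is finished, and a new one starts at any differing arc. On an open one, `a`
    -- has larger out-degree in `D` than in `D'`, so a differing arc leaves it.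
    by_cases hne : a = b
    · obtain ⟨e, he⟩ : ∃ e, D e ≠ D' e := by
        obtain ⟨e, he⟩ := card_pos.1 (by omega : 0 < #{e | D e ≠ D' e})
        exact ⟨e, (mem_filter.1 he).2⟩
      subst hne
      exact main e (D e).1 he fun Q => by rw [hab]; ring
    · have hdeg : deg D' a < deg D a := by
        have h1 := hab {a}
        rw [deg_eq, deg_eq, hs.inside_eq]
        simp only [ind, mem_singleton, if_true, if_neg (Ne.symm hne)] at h1
        omega
      obtain ⟨e, he1, he2⟩ := exists_mem_notMem_of_card_lt_card hdeg
      simp only [mem_filter, mem_univ, true_and] at he1 he2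
      exact main e b (fun h => he2 (h ▸ he1)) (he1 ▸ hab)

/-- The total out-degree deficit is at most `|E|`, and each exchange lowers it at the cost of at
most `|V|` flips. At deficit 0 all out-degrees agree, hence all cut values do, and at most `|E|`
arcs remain to be flipped. -/
lemma flips_of_isConn {D D' : E → V × V} (hs : Same D D') (h : IsConn (k + 1) D)
    (h' : IsConn (k + 1) D') :
    Flips k (Fintype.card E * Fintype.card V + Fintype.card E) D D' := by
  have main : ∀ (m : ℕ) (D : E → V × V), Same D D' → IsConn (k + 1) D →
      ∑ v, (deg D' v - deg D v) ≤ m → Flips k (m * Fintype.card V + Fintype.card E) D D' := by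
    intro m
    induction m using Nat.strong_induction_on with
    | _ m ih =>
    intro D hs h hm
    by_cases hd : ∃ t, deg D t < deg D' t
    · obtain ⟨t, ht⟩ := hd
      obtain ⟨D'', h1, h2, h3⟩ := exists_flips_exchange hs h h' ht
      obtain ⟨m, rfl⟩ : ∃ l, m = l + 1 := ⟨m - 1, by omega⟩
      refine (h1.trans (ih m (by omega) D'' (h1.same.symm.trans hs) h2 (by omega))).mono ?_
      rw [Nat.succ_mul]
      omega
    · push Not at hd
      have heq : ∀ v, deg D' v = deg D v := by
        have := (sum_eq_sum_iff_of_le (fun v _ => hd v)).1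
          ((sum_deg_univ D').trans (sum_deg_univ D).symm)
        exact fun v => this v (mem_univ v)
      have hout : ∀ Q, outDeg D Q = outDeg D' Q := by
        intro Q
        have h1 := sum_deg D Q
        have h2 := sum_deg D' Q
        rw [hs.inside_eq, sum_congr rfl fun v _ => heq v, h1] at h2
        omega
      rcases isEmpty_or_nonempty V with hV | ⟨⟨a⟩⟩
      · have : D = D' := by funext e; exact (hV.false (D e).1).elim
        subst this
        exact .refl _ _
      · refine (flips_of_outDeg_eq h' _ D a a hs rfl fun Q => by rw [hout]; ring).mono ?_
        exact (card_le_univ _).trans (Nat.le_add_left _ _)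
  refine main _ D hs h ?_
  calc ∑ v, (deg D' v - deg D v) ≤ ∑ v, deg D' v := sum_le_sum fun v _ => Nat.sub_le _ _
    _ = Fintype.card E := sum_deg_univ D'

end

section

variable {V E : Type*} [Fintype V] [DecidableEq V] [Fintype E]
variable {k : ℕ} {D : E → V × V}

/-! ### Increasing the edge-connectivity -/

/-- A tight set that contains a set that is tight in the other direction. -/
def Impure (k : ℕ) (D : E → V × V) (W : Finset V) : Prop :=
  (OutTight k D W ∧ ∃ Z ⊆ W, InTight k D Z) ∨ (InTight k D W ∧ ∃ T ⊆ W, OutTight k D T)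

lemma impure_rev {W : Finset V} : Impure k (rev D) W ↔ Impure k D W := by
  simp only [Impure, outTight_rev, inTight_rev]
  exact or_comm

omit [Fintype V] in
/-- The arcs from `W \ A` to `A` bound the difference of the out-degrees of `W \ A` and `W`. -/
lemma outDeg_sdiff_le {W A : Finset V}
    (hno : ∀ e, (D e).1 ∈ W → (D e).1 ∉ A → (D e).2 ∉ A) : outDeg D (W \ A) ≤ outDeg D W := by
  refine card_le_card fun e he => ?_
  simp only [mem_filter, mem_univ, true_and, mem_sdiff, not_and, not_not] at he ⊢
  exact ⟨he.1.1, fun h => hno e he.1.1 he.1.2 (he.2 h)⟩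

/-- If no arc leads from `Z \ A` to `A ∩ Z`, then the in-degree of `A ∩ Z` is at most that
of `Z`. -/
lemma outDeg_compl_inter_le {Z A : Finset V}
    (hno : ∀ e, (D e).1 ∈ Z → (D e).2 ∈ Z → (D e).2 ∈ A → (D e).1 ∈ A) :
    outDeg D (A ∩ Z)ᶜ ≤ outDeg D Zᶜ := by
  refine card_le_card fun e he => ?_
  simp only [mem_filter, mem_univ, true_and, mem_compl, mem_inter, not_not] at he ⊢
  exact ⟨fun h => he.1 ⟨hno e h he.2.2 he.2.1, h⟩, he.2.2⟩

/-- The region in which a path is reversed: everything, or an out-tight set, that contains tight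
sets of both kinds, and that contains properly no tight set of one kind containing one of the
other. -/
structure Region (k : ℕ) (D : E → V × V) (W : Finset V) : Prop where
  eq_or : W = univ ∨ OutTight k D W
  exists_in : ∃ Z ⊆ W, InTight k D Z
  exists_out : ∃ T ⊆ W, OutTight k D T
  eq_of_impure : ∀ Q ⊆ W, Impure k D Q → Q = W

namespace Region
variable {W : Finset V}

lemma not_inTight (hW : Region k D W) (hG : IsUConn (2 * k + 2) D) : ¬ InTight k D W := by
  rcases hW.eq_or with h | h
  · exact fun h' => h'.2.1 h
  · exact hG.not_inTight_of_outTight h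

/-- Such a `Z` would be impure, hence equal to `W`, which is not in-tight. -/
lemma not_outTight_subset (hW : Region k D W) (hG : IsUConn (2 * k + 2) D) {Z T : Finset V}
    (hZW : Z ⊆ W) (hZ : InTight k D Z) (hTZ : T ⊆ Z) : ¬ OutTight k D T := fun hT =>
  hW.not_inTight hG (hW.eq_of_impure Z hZW (Or.inr ⟨hZ, T, hTZ, hT⟩) ▸ hZ)

/-- Intersecting in-tight subsets of a region do not cover everything. -/
lemma union_ne_univ (hW : Region k D W) (hG : IsUConn (2 * k + 2) D) {Z Z' : Finset V}
    (hZW : Z ⊆ W) (hZ : InTight k D Z) (hZ' : InTight k D Z') : Z ∪ Z' ≠ univ := fun hu => by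
  refine hW.not_outTight_subset hG hZW hZ (T := Z'ᶜ) (fun v hv => ?_) (outTight_compl.2 hZ')
  have : v ∈ Z ∪ Z' := hu ▸ mem_univ v
  exact (mem_union.1 this).resolve_right (mem_compl.1 hv)

/-- A vertex of a minimal out-tight subset that lies in no in-tight subset of it lies in no
in-tight subset of the region. -/
lemma notMem_of_inTight (hW : Region k D W) (h : IsConn k D) (hG : IsUConn (2 * k + 2) D)
    {T : Finset V} (hT : Minimal (OutTight k D) T) {t : V} (ht : t ∈ T)
    (htZ : ∀ Z ⊆ T, InTight k D Z → t ∉ Z) {Z : Finset V} (hZW : Z ⊆ W) (hZ : InTight k D Z) :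
    t ∉ Z := by
  intro htZ'
  by_cases h1 : Z ⊆ T
  · exact htZ Z h1 hZ htZ'
  by_cases h2 : T ⊆ Z
  · exact hW.not_outTight_subset hG hZW hZ h2 hT.prop
  have h3 := (h.tight_sdiff hT.prop hZ h2 h1).1
  have := hT.eq_of_le h3 sdiff_subset
  rw [← this] at ht
  exact (mem_sdiff.1 ht).2 htZ'

/-- Arcs inside `W` along which the membership in in-tight subsets of `W` is monotone. -/
def Arc (k : ℕ) (D : E → V × V) (W : Finset V) (a b : V) : Prop :=
  (∃ e, D e = (a, b)) ∧ a ∈ W ∧ b ∈ W ∧ ∀ Z ⊆ W, InTight k D Z → b ∈ Z → a ∈ Z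

lemma Arc.mem_of_reflTransGen {s v : V} (hsv : Relation.ReflTransGen (Arc k D W) s v) (hs : s ∈ W) :
    v ∈ W ∧ ∀ Z ⊆ W, InTight k D Z → v ∈ Z → s ∈ Z := by
  induction hsv with
  | refl => exact ⟨hs, fun _ _ _ h => h⟩
  | tail _ h ih => exact ⟨h.2.2.1, fun Z hZW hZ hv => ih.2 Z hZW hZ (h.2.2.2 Z hZW hZ hv)⟩

/-- The vertices that reach `t` via monotone arcs include a whole minimal in-tight set. -/
lemma exists_source (hW : Region k D W) (h : IsConn k D) (hG : IsUConn (2 * k + 2) D)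
    {t : V} (htW : t ∈ W) (htZ : ∀ Z ⊆ W, InTight k D Z → t ∉ Z) :
    ∃ S ⊆ W, Minimal (InTight k D) S ∧ ∀ s ∈ S, Relation.ReflTransGen (Arc k D W) s t := by
  classical
  set A : Finset V := {v ∈ W | Relation.ReflTransGen (Arc k D W) v t} with hA
  have hmem : ∀ {v}, v ∈ A ↔ v ∈ W ∧ Relation.ReflTransGen (Arc k D W) v t := by simp [hA]
  have htA : t ∈ A := hmem.2 ⟨htW, .refl⟩
  have hAW : A ⊆ W := filter_subset _ _
  -- Otherwise every arc of `W` into `A` is monotone, so none comes from `W \ A`, and the out-degree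
  -- of `W \ A` is at most that of `W`.
  have hex : ∃ Z, Z ⊆ W ∧ InTight k D Z ∧ (A ∩ Z).Nonempty := by
    by_contra! hcon
    have hno : ∀ e, (D e).1 ∈ W → (D e).1 ∉ A → (D e).2 ∉ A := by
      intro e he1 he2 he3
      refine he2 (hmem.2 ⟨he1, .head ⟨⟨e, rfl⟩, he1, hAW he3, fun Z hZW hZ hZe => ?_⟩
        (hmem.1 he3).2⟩)
      have := hcon Z hZW hZ
      exact absurd (mem_inter.2 ⟨he3, hZe⟩) (this ▸ notMem_empty _)
    obtain ⟨Z, hZW, hZ⟩ := hW.exists_in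
    have hZA : Z ⊆ W \ A := fun v hv => mem_sdiff.2 ⟨hZW hv, fun hvA =>
      absurd (mem_inter.2 ⟨hvA, hv⟩) (hcon Z hZW hZ ▸ notMem_empty _)⟩
    have hn : (W \ A).Nonempty := hZ.1.mono hZA
    have hle := outDeg_sdiff_le hno
    have hu : W \ A ≠ univ := fun hu =>
      (mem_sdiff.1 (hu ▸ mem_univ t : t ∈ W \ A)).2 htA
    have h1 := h _ hn hu
    rcases hW.eq_or with rfl | hWo
    -- This forces `k = 0`, a case needed for the induction that starts at arbitrary orientations;
    -- then `A` is an in-tight set containing `t`.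
    · have h0 : outDeg D (univ : Finset V) = 0 := by simp [outDeg]
      have hAZ : InTight k D A := by
        refine ⟨⟨t, htA⟩, ?_, ?_⟩
        · intro hAu
          simp [hAu] at hn
        · rw [compl_eq_univ_sdiff]; omega
      exact htZ A hAW hAZ htA
    · have hT : OutTight k D (W \ A) := ⟨hn, hu, by have := hWo.2.2; omega⟩
      have := hW.eq_of_impure _ sdiff_subset (Or.inl ⟨hT, Z, hZA, hZ⟩)
      exact (mem_sdiff.1 (this ▸ htW)).2 htA
  obtain ⟨Z, hZ⟩ := exists_minimal_of_wellFoundedLT _ hex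
  obtain ⟨hZW, hZt, hAZ⟩ := hZ.prop
  -- A violating arc is not monotone, so it enters an in-tight `Z'`, and `Z ∩ Z'` contradicts the
  -- minimality of `Z`.
  have hno : ∀ e, (D e).1 ∈ Z → (D e).2 ∈ Z → (D e).2 ∈ A → (D e).1 ∈ A := by
    intro e he1 he2 he3
    by_contra he4
    have hnot : ¬ Arc k D W (D e).1 (D e).2 := fun harc =>
      he4 (hmem.2 ⟨hZW he1, .head harc (hmem.1 he3).2⟩)
    have : ∃ Z' ⊆ W, InTight k D Z' ∧ (D e).2 ∈ Z' ∧ (D e).1 ∉ Z' := by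
      by_contra! hcon
      exact hnot ⟨⟨e, rfl⟩, hZW he1, hZW he2, hcon⟩
    obtain ⟨Z', hZ'W, hZ't, h2, h1⟩ := this
    have h3 := h.inTight_inter hZt hZ't ⟨_, mem_inter.2 ⟨he2, h2⟩⟩
      (hW.union_ne_univ hG hZW hZt hZ't)
    have h4 := hZ.eq_of_le (y := Z ∩ Z') ⟨inter_subset_left.trans hZW, h3,
      ⟨_, mem_inter.2 ⟨he3, mem_inter.2 ⟨he2, h2⟩⟩⟩⟩ inter_subset_left
    exact h1 (mem_inter.1 (h4 ▸ he1)).2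
  have h1 := outDeg_compl_inter_le hno
  have hu : A ∩ Z ≠ univ := ne_univ_of_subset inter_subset_right hZt.2.1
  have h2 := h.compl_le hAZ hu
  have h3 : InTight k D (A ∩ Z) := ⟨hAZ, hu, by have := hZt.2.2; omega⟩
  have h4 : A ∩ Z = Z := hZ.eq_of_le ⟨inter_subset_right.trans hZW, h3, by
    rwa [← inter_assoc, inter_self]⟩ inter_subset_right
  have hZA : Z ⊆ A := inter_eq_right.1 h4
  refine ⟨Z, hZW, ⟨hZt, fun Z' hZ' hle => ?_⟩, fun s hs => (hmem.1 (hZA hs)).2⟩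
  refine (hZ.eq_of_le ⟨hle.trans hZW, hZ', ?_⟩ hle).ge
  rw [inter_eq_right.2 (hle.trans hZA)]
  exact hZ'.1

/-- No out-tight set contains `s` but misses a vertex reachable from `s` via monotone arcs. -/
lemma mem_of_outTight (hW : Region k D W) (h : IsConn k D) (hG : IsUConn (2 * k + 2) D)
    {S : Finset V} (hS : Minimal (InTight k D) S) (hSW : S ⊆ W) {s v : V} (hs : s ∈ S)
    (hsv : Relation.ReflTransGen (Arc k D W) s v) {Q : Finset V} (hQ : OutTight k D Q)
    (hsQ : s ∈ Q) : v ∈ Q := by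
  obtain ⟨hvW, hmono⟩ := Arc.mem_of_reflTransGen hsv (hSW hs)
  by_contra hvQ
  -- If `Qᶜ` lies in `W`, it is an in-tight set that monotone arcs cannot enter. Otherwise `Q ∩ W`
  -- is out-tight and contains `S`, so it is impure and equals `W`.
  by_cases hu : Q ∪ W = univ
  · have hsub : Qᶜ ⊆ W := fun x hx => by
      have : x ∈ Q ∪ W := hu ▸ mem_univ x
      exact (mem_union.1 this).resolve_left (mem_compl.1 hx)
    exact mem_compl.1 (hmono _ hsub (inTight_compl.2 hQ) (mem_compl.2 hvQ)) hsQ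
  · have hWo : OutTight k D W := hW.eq_or.resolve_left fun hW' => hu (by simp [hW'])
    have hI := h.outTight_inter hQ hWo ⟨s, mem_inter.2 ⟨hsQ, hSW hs⟩⟩ hu
    have hSQ : S ⊆ Q := by
      by_contra hSQ
      by_cases hQS : Q ⊆ S
      · exact hW.not_outTight_subset hG hSW hS.prop hQS hQ
      · have := hS.eq_of_le (h.tight_sdiff hQ hS.prop hQS hSQ).2 sdiff_subset
        exact (mem_sdiff.1 (this.symm ▸ hs : s ∈ S \ Q)).2 hsQ
    have := hW.eq_of_impure _ inter_subset_right
      (Or.inl ⟨hI, S, subset_inter hSQ hSW, hS.prop⟩)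
    exact hvQ (mem_inter.1 (this.symm ▸ hvW : v ∈ Q ∩ W)).1

end Region

variable [DecidableEq E]

/-- One round within a region. -/
lemma Region.exists_flips {W : Finset V} (hW : Region k D W) (h : IsConn k D)
    (hG : IsUConn (2 * k + 2) D) :
    ∃ D', Flips k (Fintype.card V) D D' ∧ (∀ Q, Tight k D' Q → ∃ Z ⊆ Q, Tight k D Z) ∧
      ∃ S, Minimal (Tight k D) S ∧ ¬ Tight k D' S := by
  obtain ⟨T₀, hT₀W, hT₀⟩ := hW.exists_out
  obtain ⟨T, hTT₀, hT⟩ := exists_minimal_le_of_wellFoundedLT _ T₀ hT₀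
  have hTW : T ⊆ W := hTT₀.trans hT₀W
  obtain ⟨t, htT, htZ, htY⟩ := exists_good_vertex h hG hT
  have htW : ∀ Z ⊆ W, InTight k D Z → t ∉ Z := fun Z => hW.notMem_of_inTight h hG hT htT htZ
  obtain ⟨S, hSW, hS, hreach⟩ := hW.exists_source h hG (hTW htT) htW
  have hSr : Minimal (OutTight k (EdgeFlip.rev D)) S := by
    have : OutTight k (EdgeFlip.rev D) = InTight k D := by
      funext Q; exact propext outTight_rev
    rwa [this]
  -- All of `S` reaches `t`, so the start can be chosen freely in `S`: the good vertex for the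
  -- reversed digraph.
  obtain ⟨s, hsS, -, hsQ⟩ := exists_good_vertex h.rev hG.rev hSr
  simp only [outDeg_rev, compl_compl, inTight_rev] at hsQ
  have hcut : ∀ v, Relation.ReflTransGen (Region.Arc k D W) s v → ∀ D'' : E → V × V,
      (∀ Q, (outDeg D'' Q : ℤ) = outDeg D Q - ind Q s + ind Q v) → IsConn k D'' := by
    intro v hv D'' hD'' Q hQ hQu
    have h1 := hD'' Q
    have h2 := h Q hQ hQu
    have h3 : outDeg D Q = k → s ∈ Q → v ∈ Q := fun h3 =>
      hW.mem_of_outTight h hG hS hSW hsS hv ⟨hQ, hQu, h3⟩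
    unfold ind at h1
    split_ifs at h1 with h4 h5 h5
    · omega
    · have : outDeg D Q ≠ k := fun h6 => h5 (h3 h6 h4)
      omega
    · omega
    · omega
  obtain ⟨D', hfl, hD'⟩ := Flips.of_reflTransGen (fun _ _ h => h.1) (hreach s hsS) hcut
  have htS : t ∉ S := htW S hSW hS.prop
  refine ⟨D', hfl, ?_, S, ⟨Or.inr hS.prop, ?_⟩, ?_⟩
  · rintro Q (hQ | hQ)
    · by_cases hk : outDeg D Q = k
      · exact ⟨Q, Subset.rfl, Or.inl ⟨hQ.1, hQ.2.1, hk⟩⟩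
      have h1 := hD' Q
      rw [hQ.2.2] at h1
      have h2 := h Q hQ.1 hQ.2.1
      have h3 : s ∈ Q ∧ outDeg D Q = k + 1 := by
        unfold ind at h1
        split_ifs at h1 with h4 h5 h5
        · omega
        · exact ⟨h4, by omega⟩
        · omega
        · omega
      by_cases h4 : S ⊆ Q
      · exact ⟨S, h4, Or.inr hS.prop⟩
      by_cases h5 : Q ⊆ S
      · obtain ⟨Z, hZ, hZ'⟩ := hsQ Q h5 h3.1 h3.2.le
        exact ⟨Z, hZ, Or.inl hZ'⟩
      -- `Q` and `S` cross, and the right-hand side is `2k + 1`. As `S \ Q` misses `s`, minimality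
      -- of `S` gives it in-degree at least `k + 1`, so `Q \ S` is out-tight.
      have h6 := outDeg_sdiff_add_le D Q S
      rw [← sdiff_nonempty] at h4 h5
      have h7 := h _ h5 (ne_univ_of_subset sdiff_subset hQ.2.1)
      have hSu := ne_univ_of_subset (sdiff_subset (s := S) (t := Q)) hS.prop.2.1
      have h8 := h.compl_le h4 hSu
      have h9 : outDeg D (S \ Q)ᶜ ≠ k := fun h9 => by
        have := hS.eq_of_le ⟨h4, hSu, h9⟩ sdiff_subset
        exact (mem_sdiff.1 (this.symm ▸ hsS : s ∈ S \ Q)).2 h3.1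
      have := hS.prop.2.2
      exact ⟨Q \ S, sdiff_subset, Or.inl ⟨h5, ne_univ_of_subset sdiff_subset hQ.2.1, by omega⟩⟩
    · by_cases hk : outDeg D Qᶜ = k
      · exact ⟨Q, Subset.rfl, Or.inr ⟨hQ.1, hQ.2.1, hk⟩⟩
      have h1 := hD' Qᶜ
      rw [hQ.2.2] at h1
      have h2 := h.compl_le hQ.1 hQ.2.1
      have h3 : t ∈ Q ∧ outDeg D Qᶜ = k + 1 := by
        simp only [ind, mem_compl] at h1
        by_cases h4 : s ∈ Q <;> by_cases h5 : t ∈ Q <;> simp [h4, h5] at h1 <;>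
          first | exact ⟨h5, by omega⟩ | omega
      by_cases h4 : T ⊆ Q
      · exact ⟨T, h4, Or.inl hT.prop⟩
      by_cases h5 : Q ⊆ T
      · obtain ⟨Z, hZ, hZ'⟩ := htY Q h5 h3.1 h3.2.le
        exact ⟨Z, hZ, Or.inr hZ'⟩
      have h6 := outDeg_sdiff_add_le D T Q
      rw [← sdiff_nonempty] at h4 h5
      have h7 := h.compl_le h5 (ne_univ_of_subset sdiff_subset hQ.2.1)
      have hTu := ne_univ_of_subset (sdiff_subset (s := T) (t := Q)) hT.prop.2.1
      have h8 := h _ h4 hTu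
      have h9 : outDeg D (T \ Q) ≠ k := fun h9 => by
        have := hT.eq_of_le ⟨h4, hTu, h9⟩ sdiff_subset
        exact (mem_sdiff.1 (this.symm ▸ htT : t ∈ T \ Q)).2 h3.1
      have := hT.prop.2.2
      exact ⟨Q \ T, sdiff_subset, Or.inr ⟨h5, ne_univ_of_subset sdiff_subset hQ.2.1, by omega⟩⟩
  · rintro Q (hQ | hQ) hle
    · exact absurd hQ (hW.not_outTight_subset hG hSW hS.prop hle)
    · exact hS.le_of_le hQ hle
  -- The in-degree of `S` rises to `k + 1`; its out-degree was at least `k + 2` and drops by one.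
  · have h1 := hD' S
    have h2 := hD' Sᶜ
    have h3 := hG S hS.prop.1 hS.prop.2.1
    have h4 := hS.prop.2.2
    simp only [ind, mem_compl, hsS, htS, if_true, if_false, not_true, not_false_iff] at h1 h2
    rintro (hQ | hQ)
    · have := hQ.2.2
      omega
    · have := hQ.2.2
      omega

/-- One round: reverse a path so that every new tight set contains an old one, and some minimal
tight set is not tight any more. -/
lemma exists_flips_round (h : IsConn k D) (hG : IsUConn (2 * k + 2) D)
    (hk : ¬ IsConn (k + 1) D) :
    ∃ D', Flips k (Fintype.card V) D D' ∧ (∀ Q, Tight k D' Q → ∃ Z ⊆ Q, Tight k D Z) ∧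
      ∃ S, Minimal (Tight k D) S ∧ ¬ Tight k D' S := by
  by_cases himp : ∃ W, Impure k D W
  · obtain ⟨W, hW⟩ := exists_minimal_of_wellFoundedLT _ himp
    have heq : ∀ Q ⊆ W, Impure k D Q → Q = W := fun Q hQ hQ' => hW.eq_of_le hQ' hQ
    rcases hW.prop with hW' | hW'
    · exact Region.exists_flips ⟨Or.inr hW'.1, hW'.2, ⟨W, Subset.rfl, hW'.1⟩, heq⟩ h hG
    · have hR : Region k (rev D) W := by
        refine ⟨Or.inr (outTight_rev.2 hW'.1), ?_, ⟨W, Subset.rfl, outTight_rev.2 hW'.1⟩, ?_⟩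
        · simpa only [inTight_rev] using hW'.2
        · simpa only [impure_rev] using heq
      obtain ⟨D', h1, h2, S, h3, h4⟩ := hR.exists_flips h.rev hG.rev
      have ht : Tight k (rev D) = Tight k D := by funext Q; exact propext tight_rev
      rw [ht] at h2 h3
      rw [← rev_rev D', tight_rev] at h4
      refine ⟨rev D', by simpa only [rev_rev] using h1.rev, fun Q hQ => ?_, S, h3, ?_⟩
      · exact h2 Q (tight_rev.1 hQ)
      · exact h4
  · obtain ⟨Q, hQ, hQu, hlt⟩ : ∃ Q : Finset V, Q.Nonempty ∧ Q ≠ univ ∧ outDeg D Q < k + 1 := by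
      simpa only [IsConn, not_forall, not_le, exists_prop] using hk
    have hT : OutTight k D Q := ⟨hQ, hQu, by have := h Q hQ hQu; omega⟩
    exact Region.exists_flips (W := univ) ⟨Or.inl rfl, ⟨Qᶜ, subset_univ _, inTight_compl.2 hT⟩,
      ⟨Q, subset_univ _, hT⟩, fun Q _ hQ => absurd ⟨Q, hQ⟩ himp⟩ h hG

end

/-! ### The potential and the number of rounds -/

section

variable {V E : Type*} [Fintype V] [DecidableEq V] [Fintype E]
variable {k : ℕ} {D : E → V × V}

open Classical in
/-- The minimal tight sets. -/
noncomputable def minTight (k : ℕ) (D : E → V × V) : Finset (Finset V) :=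
  {X | Minimal (Tight k D) X}

/-- The potential that decreases in each round. -/
noncomputable def potential (k : ℕ) (D : E → V × V) : ℕ :=
  ∑ X ∈ minTight k D, (Fintype.card V - #X)

lemma mem_minTight {X : Finset V} : X ∈ minTight k D ↔ Minimal (Tight k D) X := by
  simp [minTight]

lemma Tight.nonempty {X : Finset V} (h : Tight k D X) : X.Nonempty := by
  rcases h with h | h <;> exact h.1

lemma Tight.ne_univ {X : Finset V} (h : Tight k D X) : X ≠ univ := by
  rcases h with h | h <;> exact h.2.1

lemma potential_le (h : IsConn k D) (hG : IsUConn (2 * k + 2) D) :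
    potential k D ≤ Fintype.card V * Fintype.card V := by
  have hcard : #(minTight k D) ≤ Fintype.card V := by
    calc #(minTight k D) = ∑ X ∈ minTight k D, 1 := by simp
      _ ≤ ∑ X ∈ minTight k D, #X := sum_le_sum fun X hX =>
        card_pos.2 (mem_minTight.1 hX).prop.nonempty
      _ = #((minTight k D).biUnion id) := by
        rw [card_biUnion]
        · rfl
        · intro X hX Y hY hne
          exact minimal_tight_disjoint h hG (mem_minTight.1 hX) (mem_minTight.1 hY) hne
      _ ≤ Fintype.card V := card_le_univ _
  calc potential k D ≤ #(minTight k D) * Fintype.card V :=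
        sum_le_card_nsmul _ _ _ fun X _ => Nat.sub_le _ _
    _ ≤ _ := Nat.mul_le_mul_right _ hcard

/-- Each new minimal tight set contains an old one, and disjointness makes this choice injective.
The potential drops strictly because `S` is either not chosen, losing a positive term, or chosen for
a strictly larger set. -/
lemma potential_lt {D' : E → V × V} (h : IsConn k D') (hG : IsUConn (2 * k + 2) D')
    (hsub : ∀ Q, Tight k D' Q → ∃ Z ⊆ Q, Tight k D Z) {S : Finset V}
    (hS : Minimal (Tight k D) S) (hS' : ¬ Tight k D' S) : potential k D' < potential k D := by
  have hex : ∀ X, ∃ Z, X ∈ minTight k D' → Z ⊆ X ∧ Z ∈ minTight k D := by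
    intro X
    by_cases hX : X ∈ minTight k D'
    · obtain ⟨Z, hZX, hZ⟩ := hsub X (mem_minTight.1 hX).prop
      obtain ⟨Y, hYZ, hY⟩ := exists_minimal_le_of_wellFoundedLT _ Z hZ
      exact ⟨Y, fun _ => ⟨hYZ.trans hZX, mem_minTight.2 hY⟩⟩
    · exact ⟨∅, fun h => absurd h hX⟩
  choose m hm using hex
  have hinj : Set.InjOn m (minTight k D') := by
    intro X hX Y hY hXY
    by_contra hne
    have hd := minimal_tight_disjoint h hG (mem_minTight.1 hX) (mem_minTight.1 hY) hne
    have hmX := hm X hX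
    have hmY := hm Y hY
    rw [← hXY] at hmY
    exact (mem_minTight.1 hmX.2).prop.nonempty.ne_empty
      (disjoint_self.1 ((hd.mono_left hmX.1).mono_right hmY.1))
  have himg : (minTight k D').image m ⊆ minTight k D := by
    intro Z hZ
    obtain ⟨X, hX, rfl⟩ := mem_image.1 hZ
    exact (hm X hX).2
  have hle : ∀ X ∈ minTight k D', Fintype.card V - #X ≤ Fintype.card V - #(m X) := fun X hX =>
    Nat.sub_le_sub_left (card_le_card (hm X hX).1) _
  have hsum : ∑ X ∈ minTight k D', (Fintype.card V - #(m X)) =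
      ∑ Z ∈ (minTight k D').image m, (Fintype.card V - #Z) :=
    (sum_image (f := fun Z => Fintype.card V - #Z) hinj).symm
  have hSm : S ∈ minTight k D := mem_minTight.2 hS
  by_cases hSi : S ∈ (minTight k D').image m
  · obtain ⟨X, hX, hXS⟩ := mem_image.1 hSi
    have hlt : Fintype.card V - #X < Fintype.card V - #(m X) := by
      have hss : m X ⊂ X := (hm X hX).1.ssubset_of_ne fun he =>
        hS' (by rw [← hXS, he]; exact (mem_minTight.1 hX).prop)
      have := card_lt_card hss
      have := card_le_univ X
      omega
    calc potential k D' < ∑ X ∈ minTight k D', (Fintype.card V - #(m X)) :=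
          sum_lt_sum hle ⟨X, hX, hlt⟩
      _ ≤ potential k D := hsum ▸ sum_le_sum_of_subset himg
  · calc potential k D' ≤ ∑ X ∈ minTight k D', (Fintype.card V - #(m X)) := sum_le_sum hle
      _ < potential k D := by
        rw [hsum]
        have := card_lt_univ_of_notMem (s := S) (x := _)
          (not_forall.1 fun hall => hS.prop.ne_univ (eq_univ_iff_forall.2 hall)).choose_spec
        exact sum_lt_sum_of_subset himg hSm hSi (by omega) fun _ _ _ => Nat.zero_le _

section
variable [DecidableEq E]

/-- The edge-connectivity of an orientation can be increased by monotone flips. -/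
lemma exists_flips_isConn_succ (h : IsConn k D) (hG : IsUConn (2 * k + 2) D) :
    ∃ D', Flips k (Fintype.card V ^ 3) D D' ∧ IsConn (k + 1) D' := by
  have main : ∀ (m : ℕ) (D : E → V × V), IsConn k D → IsUConn (2 * k + 2) D →
      potential k D ≤ m → ∃ D', Flips k (m * Fintype.card V) D D' ∧ IsConn (k + 1) D' := by
    intro m
    induction m using Nat.strong_induction_on with
    | _ m ih =>
    intro D h hG hm
    by_cases hk : IsConn (k + 1) D
    · exact ⟨D, .refl _ _, hk⟩
    · obtain ⟨D', h1, h2, S, h3, h4⟩ := exists_flips_round h hG hk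
      have hD' := h1.isConn h
      have hG' := h1.same.isUConn hG
      have hlt := potential_lt hD' hG' h2 h3 h4
      obtain ⟨m, rfl⟩ : ∃ l, m = l + 1 := ⟨m - 1, by omega⟩
      obtain ⟨D'', h5, h6⟩ := ih m (by omega) D' hD' hG' (by omega)
      refine ⟨D'', (h1.trans h5).mono ?_, h6⟩
      rw [Nat.succ_mul, add_comm]
  obtain ⟨D', h1, h2⟩ := main _ D h hG (potential_le h hG)
  exact ⟨D', h1.mono (by rw [pow_three, mul_assoc]), h2⟩

/-- Nash-Williams: a `2k`-edge-connected graph has a `k`-edge-connected orientation. -/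
lemma exists_isConn (hG : IsUConn (2 * k) D) : ∃ D', Same D D' ∧ IsConn k D' := by
  induction k with
  -- Every orientation is `0`-edge-connected; each induction step raises the connectivity by one.
  | zero => exact ⟨D, .refl _, fun _ _ _ => Nat.zero_le _⟩
  | succ k ih =>
    obtain ⟨D', h1, h2⟩ := ih fun Q hQ hQu => le_trans (by omega) (hG Q hQ hQu)
    obtain ⟨D'', h3, h4⟩ := exists_flips_isConn_succ h2 (h1.isUConn hG)
    exact ⟨D'', h1.trans h3.same, h4⟩

omit [DecidableEq E] in
lemma card_le_of_isConn (hV : 2 ≤ Fintype.card V) (h : IsConn (k + 1) D) :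
    Fintype.card V ≤ Fintype.card E := by
  rw [← sum_deg_univ D, ← card_univ, card_eq_sum_ones]
  refine sum_le_sum fun v _ => ?_
  have hv : ({v} : Finset V) ≠ univ := by
    intro hv
    have := congrArg card hv
    rw [card_singleton, card_univ] at this
    omega
  have := h {v} (singleton_nonempty v) hv
  rw [deg_eq]
  omega

end

end

/-! ### Transfer to orientations of `Graph` -/

section Transfer
variable {V E : Type*} {G : Graph V E} {k : ℕ}

/-- The arcs of an orientation. -/
def arcs (O : G.Orientation) : E(G) → V(G) × V(G) := fun e =>
  (⟨O.tail e, (O.isLink e).left_mem⟩, ⟨O.head e, (O.isLink e).right_mem⟩)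

/-- Each arc joins the ends of its edge. -/
def IsLinked (D : E(G) → V(G) × V(G)) : Prop := ∀ e : E(G), G.IsLink e (D e).1 (D e).2

/-- The orientation with given arcs. -/
def orient (D : E(G) → V(G) × V(G)) (h : IsLinked D) : G.Orientation where
  tail e := (D e).1
  head e := (D e).2
  isLink := h

lemma isLinked_arcs (O : G.Orientation) : IsLinked (arcs O) := O.isLink

lemma IsLinked.of_same {D D' : E(G) → V(G) × V(G)} (h : IsLinked D) (hs : Same D D') :
    IsLinked D' := by
  intro e
  rcases hs e with he | he <;> rw [he]
  · exact h e
  · exact (h e).symm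

lemma IsLinked.same {D D' : E(G) → V(G) × V(G)} (h : IsLinked D) (h' : IsLinked D') :
    Same D D' := by
  intro e
  rcases (h e).eq_and_eq_or_eq_and_eq (h' e) with ⟨h1, h2⟩ | ⟨h1, h2⟩
  · exact Or.inl (Prod.ext (Subtype.ext h1.symm) (Subtype.ext h2.symm))
  · exact Or.inr (Prod.ext (Subtype.ext h2.symm) (Subtype.ext h1.symm))

variable [Fintype V(G)] [DecidableEq V(G)] [Fintype E(G)]

omit [Fintype V(G)] in
lemma encard_outCut {O : G.Orientation} {S : Set V} {Q : Finset V(G)}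
    (hQ : ∀ v : V(G), v ∈ Q ↔ v.1 ∈ S) : (O.outCut S).encard = outDeg (arcs O) Q := by
  rw [outDeg, ← Set.encard_coe_eq_coe_finsetCard]
  congr 1
  ext e
  rw [mem_coe, mem_filter]
  simp [Graph.Orientation.outCut, hQ, arcs]

lemma encard_inCut {O : G.Orientation} {S : Set V} {Q : Finset V(G)}
    (hQ : ∀ v : V(G), v ∈ Q ↔ v.1 ∈ S) : (O.inCut S).encard = outDeg (arcs O) Qᶜ := by
  rw [outDeg, ← Set.encard_coe_eq_coe_finsetCard]
  congr 1
  ext e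
  rw [mem_coe, mem_filter]
  simp [Graph.Orientation.inCut, hQ, arcs]

omit [DecidableEq V(G)] [Fintype E(G)] in
lemma nonempty_and_ssubset_iff {S : Set V} (hS : S ⊆ V(G)) {Q : Finset V(G)}
    (hQ : ∀ v : V(G), v ∈ Q ↔ v.1 ∈ S) :
    (Q.Nonempty ↔ S.Nonempty) ∧ (Q ≠ univ ↔ S ⊂ V(G)) := by
  constructor
  · constructor
    · rintro ⟨v, hv⟩
      exact ⟨v, (hQ v).1 hv⟩
    · rintro ⟨v, hv⟩
      exact ⟨⟨v, hS hv⟩, (hQ _).2 hv⟩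
  · rw [Set.ssubset_iff_of_subset hS]
    constructor
    · intro h
      by_contra! hcon
      exact h (eq_univ_iff_forall.2 fun v => (hQ v).2 (hcon v v.2))
    · rintro ⟨v, hv, hvS⟩ rfl
      exact hvS ((hQ ⟨v, hv⟩).1 (mem_univ _))

omit [DecidableEq V(G)] [Fintype E(G)] in
lemma exists_finset {S : Set V} : ∃ Q : Finset V(G), ∀ v : V(G), v ∈ Q ↔ v.1 ∈ S := by
  classical
  exact ⟨univ.filter fun v => v.1 ∈ S, by simp⟩

omit [Fintype V(G)] [DecidableEq V(G)] [Fintype E(G)] in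
lemma exists_set (Q : Finset V(G)) : ∃ S ⊆ V(G), ∀ v : V(G), v ∈ Q ↔ v.1 ∈ S :=
  ⟨Subtype.val '' (Q : Set V(G)), by rintro _ ⟨v, _, rfl⟩; exact v.2, by simp⟩

lemma isEdgeConnected_iff {O : G.Orientation} : O.IsEdgeConnected k ↔ IsConn k (arcs O) := by
  constructor
  · intro h Q hQ hQu
    obtain ⟨S, hS, hSQ⟩ := exists_set Q
    obtain ⟨h1, h2⟩ := nonempty_and_ssubset_iff hS hSQ
    have := (h S (h1.1 hQ) (h2.1 hQu)).1
    rw [encard_outCut hSQ] at this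
    exact_mod_cast this
  · intro h S hS hSV
    obtain ⟨Q, hQ⟩ := exists_finset (G := G) (S := S)
    obtain ⟨h1, h2⟩ := nonempty_and_ssubset_iff hSV.subset hQ
    rw [encard_outCut hQ, encard_inCut hQ]
    exact ⟨by exact_mod_cast h Q (h1.2 hS) (h2.2 hSV),
      by exact_mod_cast h.compl_le (h1.2 hS) (h2.2 hSV)⟩

lemma isUConn_arcs {m : ℕ} (hG : G.IsEdgeConnected m) (O : G.Orientation) :
    IsUConn m (arcs O) := by
  intro Q hQ hQu
  obtain ⟨S, hS, hSQ⟩ := exists_set Q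
  obtain ⟨h1, h2⟩ := nonempty_and_ssubset_iff hS hSQ
  have h3 := hG S (h1.1 hQ) (h2.1 hQu)
  have hsub : G.edgeCut S ⊆ Subtype.val '' (O.outCut S ∪ O.inCut S) := by
    rintro e ⟨x, y, hxy, hx, hy⟩
    refine ⟨⟨e, hxy.edge_mem⟩, ?_, rfl⟩
    rcases (O.isLink ⟨e, hxy.edge_mem⟩).eq_and_eq_or_eq_and_eq hxy with ⟨h4, h5⟩ | ⟨h4, h5⟩
    · exact Or.inl ⟨h4.symm ▸ hx, h5.symm ▸ hy⟩
    · exact Or.inr ⟨h4.symm ▸ hy, h5.symm ▸ hx⟩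
  have h4 := h3.trans (Set.encard_le_encard hsub)
  rw [Subtype.val_injective.encard_image] at h4
  have h5 := h4.trans (Set.encard_union_le _ _)
  rw [encard_outCut hSQ, encard_inCut hSQ] at h5
  exact_mod_cast h5

omit [DecidableEq V(G)] [Fintype V(G)] [Fintype E(G)] in
lemma exists_orientation (G : Graph V E) : Nonempty G.Orientation := by
  have h : ∀ e : E(G), ∃ x y, G.IsLink e x y := fun e => G.exists_isLink_of_mem_edgeSet e.2
  choose x y hxy using h
  exact ⟨⟨x, y, hxy⟩⟩

variable [DecidableEq E(G)]

lemma edist_le_of_flips {n : ℕ} {D D' : E(G) → V(G) × V(G)} (h : Flips k n D D') :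
    ∀ (hl : IsLinked D) (hl' : IsLinked D') (hc : (orient D hl).IsEdgeConnected k)
      (hc' : (orient D' hl').IsEdgeConnected k),
      (G.edgeFlipGraph k).edist ⟨orient D hl, hc⟩ ⟨orient D' hl', hc'⟩ ≤ n := by
  induction h with
  | refl n D => intros; simp
  | tail e h h' ih =>
    rename_i n D D'
    intro hl hl' hc hc'
    have hl1 : IsLinked D' := hl.of_same h.same
    have hc1 : (orient D' hl1).IsEdgeConnected k :=
      isEdgeConnected_iff.2 (h.isConn (isEdgeConnected_iff.1 hc))
    refine (SimpleGraph.edist_triangle (v := ⟨orient D' hl1, hc1⟩)).trans ?_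
    push_cast
    refine add_le_add (ih hl hl1 hc hc1) ?_
    -- Flipping a loop changes nothing, and the flip graph has no edge for it.
    by_cases heq : (⟨orient D' hl1, hc1⟩ : {O : G.Orientation // O.IsEdgeConnected k}) =
        ⟨orient (flip D' e) hl', hc'⟩
    · rw [heq]; simp
    · refine (SimpleGraph.edist_eq_one_iff_adj.2 ?_).le
      rw [Graph.edgeFlipGraph, SimpleGraph.fromRel_adj]
      refine ⟨heq, Or.inl ⟨e, ?_, ?_, fun f hf => ?_⟩⟩
      · simp [orient, flip]
      · simp [orient, flip]
      · simp [orient, flip, hf]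

lemma edist_le (hG : G.IsEdgeConnected (2 * k + 2))
    (O O' : {O : G.Orientation // O.IsEdgeConnected k}) :
    (G.edgeFlipGraph k).edist O O' ≤
      ((2 * (Fintype.card V(G) ^ 3 + Fintype.card E(G) ^ 2) : ℕ) : ℕ∞) := by
  obtain ⟨O, hO⟩ := O
  obtain ⟨O', hO'⟩ := O'
  -- With at most one vertex all edges are loops and there is only one orientation; `|V| ≤ |E|`,
  -- used below, may then fail.
  rcases Nat.lt_or_ge (Fintype.card V(G)) 2 with hV | hV
  · have hsub := Fintype.card_le_one_iff_subsingleton.1 (Nat.le_of_lt_succ hV)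
    have : O = O' := by
      ext e
      · exact congrArg Subtype.val (Subsingleton.elim (arcs O e).1 (arcs O' e).1)
      · exact congrArg Subtype.val (Subsingleton.elim (arcs O e).2 (arcs O' e).2)
    subst this
    simp
  have hk := isEdgeConnected_iff.1 hO
  have hk' := isEdgeConnected_iff.1 hO'
  obtain ⟨D, h1, h2⟩ := exists_flips_isConn_succ hk (isUConn_arcs hG O)
  obtain ⟨D', h1', h2'⟩ := exists_flips_isConn_succ hk' (isUConn_arcs hG O')
  have hl := (isLinked_arcs O).of_same h1.same
  have hl' := (isLinked_arcs O').of_same h1'.same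
  have h3 := flips_of_isConn (hl.same hl') h2 h2'
  have hc : (orient D hl).IsEdgeConnected k := isEdgeConnected_iff.2 (h1.isConn hk)
  have hc' : (orient D' hl').IsEdgeConnected k := isEdgeConnected_iff.2 (h1'.isConn hk')
  have e1 := edist_le_of_flips h1 (isLinked_arcs O) hl hO hc
  have e2 := edist_le_of_flips h3 hl hl' hc hc'
  have e3 := edist_le_of_flips h1' (isLinked_arcs O') hl' hO' hc'
  rw [SimpleGraph.edist_comm] at e3
  have e4 := (SimpleGraph.edist_triangle.trans (add_le_add
    (SimpleGraph.edist_triangle.trans (add_le_add e1 e2)) e3))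
  refine e4.trans ?_
  norm_cast
  -- The three stretches cost `2|V|^3 + |E||V| + |E|` in total, and `|V| ≤ |E|` absorbs the last two
  -- terms into `2|E|^2`.
  have hVE := card_le_of_isConn hV h2
  nlinarith

end Transfer

end EdgeFlip

theorem theorem2 :
    ∃ C : ℕ, ∀ (k : ℕ), 1 ≤ k →
      ∀ (V E : Type*) (G : Graph V E), V(G).Finite → E(G).Finite →
        G.IsEdgeConnected (2 * k + 2) →
          (G.edgeFlipGraph k).Connected ∧
          (G.edgeFlipGraph k).ediam ≤
            ((C * (k * V(G).ncard ^ 3 + E(G).ncard ^ 2) : ℕ) : ℕ∞) := by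
  refine ⟨2, fun k hk V E G hV hE hG => ?_⟩
  classical
  have := hV.fintype
  have := hE.fintype
  have hdist := EdgeFlip.edist_le hG
  constructor
  · have hne : Nonempty {O : G.Orientation // O.IsEdgeConnected k} := by
      obtain ⟨O⟩ := EdgeFlip.exists_orientation G
      obtain ⟨D, h1, h2⟩ := EdgeFlip.exists_isConn (k := k) (D := EdgeFlip.arcs O)
        fun Q hQ hQu => le_trans (by omega) (EdgeFlip.isUConn_arcs hG O Q hQ hQu)
      exact ⟨EdgeFlip.orient D ((EdgeFlip.isLinked_arcs O).of_same h1),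
        EdgeFlip.isEdgeConnected_iff.2 h2⟩
    refine SimpleGraph.Connected.mk fun O O' => ?_
    exact SimpleGraph.reachable_of_edist_ne_top
      ((hdist O O').trans_lt (ENat.natCast_lt_top _)).ne
  · refine SimpleGraph.ediam_le_of_edist_le fun O O' => (hdist O O').trans ?_
    rw [← Nat.card_eq_fintype_card, ← Nat.card_eq_fintype_card, Nat.card_coe_set_eq,
      Nat.card_coe_set_eq]
    norm_cast
    gcongr
    -- The bound obtained has no factor `k`; it enters only here, through `1 ≤ k`.
    exact Nat.le_mul_of_pos_left _ hk
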